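/- Let $1\le a<b$ be integers. Every finite word $u$ over the alphabet $\{a,b\}$ factorizes uniquely as $u=a_1^{p_1}\cdots a_n^{p_n}$ with $a_i\in\{a,b\}$, $a_{i+1}\ne a_i$ and $p_i\ge 1$ (with $n=0$ for the empty word $\varepsilon$). Call $u$ derivable if $p_i\in\{a,b\}$ for $2\le i\le n-1$ and, when $n\ge 1$, $1\le p_1,p_n\le b$; its derivative is then the word $\mathcal D_f(u)=\mathrm{cut}(p_1)\,p_2\cdots p_{n-1}\,\mathrm{cut}(p_n)$ over $\{a,b\}$, where $\mathrm{cut}(p)=\varepsilon$ if $1\le p\le a$ and $\mathrm{cut}(p)=b$ if $a<p\le b$, and where $\mathcal D_f(\varepsilon)=\varepsilon$ and $\mathcal D_f(a_1^{p_1})=\mathrm{cut}(p_1)$. Let $\mathcal C_f^1$ be the set of derivable words, let $\mathcal C_f^n=\{u\in\mathcal C_f^1 : \mathcal D_f(u)\in\mathcal C_f^{n-1}\}$ for $n\ge 2$, and let $\mathcal C_f^\infty=\bigcap_{n\ge 1}\mathcal C_f^n$ be the set of f-smooth words. For $n\ge 0$ let $p_{\mathcal C_f^\infty}(n)$ be the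 number of f-smooth words of length $n$, and let $$\rho=\frac{\log(a+b)}{\log\left(\frac{a+b}{2}\right)}.$$ (i) We have $p_{\mathcal C_f^\infty}(n)=\Omega(n^\rho)$, i.e. there are $C>0$ and $N\ge 0$, depending on $a$ and $b$, such that $p_{\mathcal C_f^\infty}(n)\ge C n^\rho$ for all $n\ge N$. (ii) If $a$ and $b$ are both even, then $p_{\mathcal C_f^\infty}(n)=\Theta(n^\rho)$, i.e. there are moreover $C'>0$ and $N'\ge 0$, depending on $a$ and $b$, such that $p_{\mathcal C_f^\infty}(n)\le C' n^\rho$ for all $n\ge N'$. -/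

import Mathlib

open Filter Asymptotics

/-- The finite words `A*` over the alphabet `A = {a, b}`. -/
def words (a b : ℕ) : Set (List ℕ) :=
  {u | ∀ c ∈ u, c ∈ ({a, b} : Set ℕ)}

/-- The exponents `[p₁, …, pₙ]` of the canonical factorization of a word into maximal blocks of
equal letters; the empty word gives the empty list. -/
def runLengths (u : List ℕ) : List ℕ :=
  (u.splitBy (fun x y => x == y)).map List.length

/-- The set of derivable finite words: words over `{a, b}` in which every maximal block other than
the first and the last has length in `{a, b}`, the first and the last having length in `[1, b]`. -/
def fDerivable (a b : ℕ) : Set (List ℕ) :=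
  {u | u ∈ words a b ∧
    (∀ p ∈ (runLengths u).tail.dropLast, p ∈ ({a, b} : Set ℕ)) ∧
    (∀ p ∈ (runLengths u).head?, 1 ≤ p ∧ p ≤ b) ∧
    (∀ p ∈ (runLengths u).getLast?, 1 ≤ p ∧ p ≤ b)}

/-- `cut p` is the empty word if `p ≤ a` and the one-letter word `b` if `a < p`. -/
def cut (a b p : ℕ) : List ℕ :=
  if p ≤ a then [] else [b]

/-- `p₁ p₂ … pₙ ↦ cut(p₁) p₂ … pₙ₋₁ cut(pₙ)`; a single exponent `p₁` is mapped to `cut(p₁)`. -/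
def cutEnds (a b : ℕ) : List ℕ → List ℕ
  | [] => []
  | [p] => cut a b p
  | p :: q :: ps => cut a b p ++ (q :: ps).dropLast ++
      cut a b ((q :: ps).getLast (List.cons_ne_nil q ps))

/-- The finite derivative (meaningful on derivable words). -/
def fDerivative (a b : ℕ) (u : List ℕ) : List ℕ :=
  cutEnds a b (runLengths u)

/-- The finite words that are derivable `n` times (`n ≥ 1`); for `n = 0` all words. -/
def fDerivableTimes (a b : ℕ) : ℕ → Set (List ℕ)
  | 0 => words a b
  | 1 => fDerivable a b
  | n + 2 => {u | u ∈ fDerivable a b ∧ fDerivative a b u ∈ fDerivableTimes a b (n + 1)}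

/-- The f-smooth words over `{a, b}`: the finite words that are infinitely derivable. -/
def fSmooth (a b : ℕ) : Set (List ℕ) :=
  {u | ∀ n : ℕ, 1 ≤ n → u ∈ fDerivableTimes a b n}

/-- The complexity of a language: the number of its words of length `n`
(a finite number for a language over a finite alphabet). -/
noncomputable def complexity (L : Set (List ℕ)) (n : ℕ) : ℕ :=
  {u | u ∈ L ∧ u.length = n}.ncard

/-!
The proof follows the special words of the language, that is, the words that can be prolonged in
two ways on one side. Every smooth word can be prolonged (`exists_cons_mem_fSmooth`) and suffixes of
smooth words are smooth (`tail_mem_fSmooth`), so from length `n` to length `n + 1` the number of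
smooth words grows by the number of special words of length `n` (`complexity_succ`). Write `λ = (a + b) / 2`, so that
`λ ^ ρ = a + b = 2 λ`.

The key observation is `expand_append_mem_leftSpecial_iff`: a word with at least two blocks is left
special exactly when its first block has length `a` and its derivative is left special, because
continuing or closing a block of length `a` adds a `b` or an `a` to the derivative. A special word
therefore has `2` choices of a letter and `a` or `b` choices of its free end over each special word
below it.

For the lower bound, consider the words with both ends special. From the empty word one obtains
`2 ^ k` of them at level `k` (`bispecialLevel`). The two words over a given derivative are
complementary, so their letter sums add up to `a + b` per letter, and the mean length at level `k` is
exactly computable and `O(λ ^ k)` (`sum_bispecialLevel_le`). By Markov's inequality half of them have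
length `O(λ ^ k)`. Each of them is a branching point of a tree of special words without dead ends
(`SpecialTree`), hence there are at least `2 ^ k / 2` special words of each length above `C λ ^ k`,
and of the order of `λ ^ k * 2 ^ k = (λ ^ k) ^ ρ` smooth words.

For the upper bound, when `a` and `b` are even all inner blocks have even length, which makes both
letters equally frequent up to a bounded error (`mul_length_le_of_mem_fSmooth`). Hence special words
of length at most `x` have derivatives of length at most `x / λ + O(1)`, and the special words with a
given first letter and length at most `x` number at most `a + b` times the analogous number for
`x / λ + O(1)` plus a constant (`ncard_boundedSpecialFrom_le`). Iterating gives `O(x ^ ρ)` special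
words of length at most `x`, and every smooth word count is bounded by such a number
(`complexity_fSmooth_le`).
-/

section

variable {a b c : ℕ}

/-! ### Words and their runs -/

/-- The other letter of the alphabet `{a, b}` (meaningful for `c ∈ {a, b}`). -/
def otherLetter (a b c : ℕ) : ℕ := a + b - c

/-- The word over `{a, b}` with first letter `c` whose successive blocks have the given lengths. -/
def expand (a b : ℕ) : ℕ → List ℕ → List ℕ
  | _, [] => []
  | c, p :: ps => List.replicate p c ++ expand a b (otherLetter a b c) ps


theorem otherLetter_mem (hc : c = a ∨ c = b) : otherLetter a b c = a ∨ otherLetter a b c = b := by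
  unfold otherLetter; omega

theorem otherLetter_otherLetter (hc : c = a ∨ c = b) : otherLetter a b (otherLetter a b c) = c := by
  unfold otherLetter; omega

theorem otherLetter_ne (hab : a < b) (hc : c = a ∨ c = b) : otherLetter a b c ≠ c := by
  unfold otherLetter; omega

theorem eq_or_eq_otherLetter {x : ℕ} (hc : c = a ∨ c = b) (hx : x = a ∨ x = b) :
    x = c ∨ x = otherLetter a b c := by
  unfold otherLetter; omega

theorem mem_words_cons {x : ℕ} {u : List ℕ} :
    x :: u ∈ words a b ↔ (x = a ∨ x = b) ∧ u ∈ words a b := by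
  simp [words]

theorem mem_words_append {u v : List ℕ} :
    u ++ v ∈ words a b ↔ u ∈ words a b ∧ v ∈ words a b := by
  simp [words, or_imp, forall_and]

theorem nil_mem_words : [] ∈ words a b := by simp [words]

theorem pos_of_mem_words (ha : 1 ≤ a) (hab : a < b) {m : List ℕ} (hm : m ∈ words a b) :
    ∀ p ∈ m, 1 ≤ p := by
  intro p hp
  have := hm p hp
  simp only [Set.mem_insert_iff, Set.mem_singleton_iff] at this
  omega

theorem cons_expand (p : ℕ) (ps : List ℕ) :
    c :: expand a b c (p :: ps) = expand a b c ((p + 1) :: ps) := by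
  simp [expand, List.replicate_succ]

theorem otherLetter_cons_expand (hc : c = a ∨ c = b) (ps : List ℕ) :
    otherLetter a b c :: expand a b c ps = expand a b (otherLetter a b c) (1 :: ps) := by
  simp [expand, otherLetter_otherLetter hc]

theorem expand_singleton (p : ℕ) : expand a b c [p] = List.replicate p c := by
  simp [expand]

theorem expand_mem_words (hc : c = a ∨ c = b) (ps : List ℕ) : expand a b c ps ∈ words a b := by
  induction ps generalizing c with
  | nil => exact nil_mem_words
  | cons p ps ih =>
    refine mem_words_append.2 ⟨?_, ih (otherLetter_mem hc)⟩
    intro x hx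
    rw [List.eq_of_mem_replicate hx]
    simpa using hc

theorem length_expand (ps : List ℕ) : (expand a b c ps).length = ps.sum := by
  induction ps generalizing c with
  | nil => rfl
  | cons p ps ih => simp [expand, ih]

theorem head?_expand {p : ℕ} (hp : 1 ≤ p) (ps : List ℕ) :
    (expand a b c (p :: ps)).head? = some c := by
  obtain ⟨n, rfl⟩ : ∃ n, p = n + 1 := ⟨p - 1, by omega⟩
  simp [expand, List.replicate_succ]

theorem runLengths_nil : runLengths [] = [] := rfl

theorem runLengths_replicate {p : ℕ} (hp : 1 ≤ p) : runLengths (List.replicate p c) = [p] := by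
  unfold runLengths
  rw [List.splitBy_of_isChain]
  · simp
  · simp; omega
  · simp [List.isChain_replicate_of_rel]

theorem runLengths_append {u v : List ℕ} (h : ∀ x ∈ u.getLast?, ∀ y ∈ v.head?, x ≠ y) :
    runLengths (u ++ v) = runLengths u ++ runLengths v := by
  unfold runLengths
  rw [List.splitBy_append (by simpa using h), List.map_append]

theorem getLast?_replicate_eq {p x : ℕ} (h : x ∈ (List.replicate p c).getLast?) : x = c :=
  List.eq_of_mem_replicate (List.mem_of_getLast? h)

theorem runLengths_expand (hab : a < b) (hc : c = a ∨ c = b) {ps : List ℕ}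
    (hps : ∀ p ∈ ps, 1 ≤ p) : runLengths (expand a b c ps) = ps := by
  induction ps generalizing c with
  | nil => rfl
  | cons p ps ih =>
    rw [List.forall_mem_cons] at hps
    rw [expand, runLengths_append, runLengths_replicate hps.1, ih (otherLetter_mem hc) hps.2]
    · rfl
    · intro x hx y hy
      rw [getLast?_replicate_eq hx]
      cases ps with
      | nil => simp [expand] at hy
      | cons q qs =>
        rw [head?_expand (hps.2 q (by simp))] at hy
        simp only [Option.mem_def, Option.some.injEq] at hy
        exact hy ▸ (otherLetter_ne hab hc).symm

theorem runLengths_reverse_expand (hab : a < b) (hc : c = a ∨ c = b) {ps : List ℕ}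
    (hps : ∀ p ∈ ps, 1 ≤ p) : runLengths (expand a b c ps).reverse = ps.reverse := by
  induction ps generalizing c with
  | nil => rfl
  | cons p ps ih =>
    rw [List.forall_mem_cons] at hps
    rw [expand, List.reverse_append, runLengths_append, List.reverse_replicate,
      runLengths_replicate hps.1, ih (otherLetter_mem hc) hps.2]
    · simp
    · intro x hx y hy
      rw [List.head?_reverse] at hy
      rw [getLast?_replicate_eq hy]
      rw [List.getLast?_reverse] at hx
      cases ps with
      | nil => simp [expand] at hx
      | cons q qs =>
        rw [head?_expand (hps.2 q (by simp))] at hx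
        simp only [Option.mem_def, Option.some.injEq] at hx
        exact hx ▸ otherLetter_ne hab hc

/-- Every word over `{a, b}` is recovered from its first letter and its runs. -/
theorem exists_eq_expand {u : List ℕ} (hu : u ∈ words a b) :
    ∃ c ps, (c = a ∨ c = b) ∧ (∀ p ∈ ps, 1 ≤ p) ∧ u = expand a b c ps := by
  induction u with
  | nil => exact ⟨a, [], Or.inl rfl, by simp, rfl⟩
  | cons x u ih =>
    rw [mem_words_cons] at hu
    obtain ⟨c, ps, hc, hps, rfl⟩ := ih hu.2
    cases ps with
    | nil => exact ⟨x, [1], hu.1, by simp, by simp [expand]⟩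
    | cons p ps =>
      rw [List.forall_mem_cons] at hps
      rcases eq_or_eq_otherLetter hc hu.1 with rfl | rfl
      · exact ⟨x, (p + 1) :: ps, hc, by simpa using hps.2, cons_expand p ps⟩
      · exact ⟨_, 1 :: p :: ps, otherLetter_mem hc, by simpa using hps, otherLetter_cons_expand hc _⟩

/-! ### Derivable words and the derivative in terms of runs -/

theorem cutEnds_append (p q : ℕ) (m : List ℕ) :
    cutEnds a b (p :: (m ++ [q])) = cut a b p ++ m ++ cut a b q := by
  cases m with
  | nil => simp [cutEnds]
  | cons x m =>
    simp only [List.cons_append, cutEnds]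
    have h : (x :: (m ++ [q])) = (x :: m) ++ [q] := rfl
    simp only [h, List.dropLast_concat, List.getLast_append_singleton]

theorem reverse_cut (p : ℕ) : (cut a b p).reverse = cut a b p := by
  unfold cut; split <;> rfl

theorem length_cut_le {p : ℕ} (ha : 1 ≤ a) : (cut a b p).length ≤ p := by
  unfold cut; split <;> simp; omega

theorem eq_nil_or_singleton_or_append (l : List ℕ) :
    l = [] ∨ (∃ p, l = [p]) ∨ ∃ p m q, l = p :: (m ++ [q]) := by
  rcases l with _ | ⟨p, l⟩
  · exact Or.inl rfl
  · rcases List.eq_nil_or_concat l with rfl | ⟨m, q, rfl⟩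
    · exact Or.inr (Or.inl ⟨p, rfl⟩)
    · exact Or.inr (Or.inr ⟨p, m, q, by simp⟩)

theorem nil_mem_fDerivable : [] ∈ fDerivable a b := by
  simp [fDerivable, words, runLengths_nil]

theorem expand_singleton_mem_fDerivable_iff (hab : a < b) (hc : c = a ∨ c = b) {p : ℕ}
    (hp : 1 ≤ p) : expand a b c [p] ∈ fDerivable a b ↔ p ≤ b := by
  simp [fDerivable, expand_mem_words hc, runLengths_expand hab hc (ps := [p]) (by simpa), hp]

theorem expand_append_mem_fDerivable_iff (hab : a < b) (hc : c = a ∨ c = b)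
    {p q : ℕ} {m : List ℕ} (hp : ∀ x ∈ p :: (m ++ [q]), 1 ≤ x) :
    expand a b c (p :: (m ++ [q])) ∈ fDerivable a b ↔ m ∈ words a b ∧ p ≤ b ∧ q ≤ b := by
  have h1 : 1 ≤ p := hp p (by simp)
  have h2 : 1 ≤ q := hp q (by simp)
  simp only [fDerivable, expand_mem_words hc, runLengths_expand hab hc hp, Set.mem_ofPred_eq]
  rw [← List.cons_append, List.getLast?_concat]
  simp [h1, h2, words]

theorem fDerivative_expand (hab : a < b) (hc : c = a ∨ c = b) {ps : List ℕ}
    (hps : ∀ p ∈ ps, 1 ≤ p) : fDerivative a b (expand a b c ps) = cutEnds a b ps := by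
  rw [fDerivative, runLengths_expand hab hc hps]

theorem fDerivable_cases (hab : a < b) {u : List ℕ} (hu : u ∈ fDerivable a b) :
    u = [] ∨ (∃ c p, (c = a ∨ c = b) ∧ 1 ≤ p ∧ p ≤ b ∧ u = expand a b c [p]) ∨
      ∃ c p m q, (c = a ∨ c = b) ∧ m ∈ words a b ∧ (1 ≤ p ∧ p ≤ b) ∧ (1 ≤ q ∧ q ≤ b) ∧
        u = expand a b c (p :: (m ++ [q])) := by
  obtain ⟨c, ps, hc, hps, rfl⟩ := exists_eq_expand hu.1
  rcases eq_nil_or_singleton_or_append ps with rfl | ⟨p, rfl⟩ | ⟨p, m, q, rfl⟩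
  · exact Or.inl rfl
  · have hp : 1 ≤ p := hps p (by simp)
    exact Or.inr (Or.inl ⟨c, p, hc, hp,
      (expand_singleton_mem_fDerivable_iff hab hc hp).1 hu, rfl⟩)
  · obtain ⟨hm, hp, hq⟩ := (expand_append_mem_fDerivable_iff hab hc hps).1 hu
    exact Or.inr (Or.inr ⟨c, p, m, q, hc, hm, ⟨hps p (by simp), hp⟩, ⟨hps q (by simp), hq⟩, rfl⟩)

/-! ### Smooth words -/

theorem mem_fSmooth_iff {u : List ℕ} :
    u ∈ fSmooth a b ↔ u ∈ fDerivable a b ∧ fDerivative a b u ∈ fSmooth a b := by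
  constructor
  · intro h
    refine ⟨h 1 le_rfl, fun n hn => ?_⟩
    obtain ⟨k, rfl⟩ : ∃ k, n = k + 1 := ⟨n - 1, by omega⟩
    exact (h (k + 2) (by omega)).2
  · rintro ⟨h1, h2⟩ n hn
    rcases n with _ | _ | n
    · omega
    · exact h1
    · exact ⟨h1, h2 (n + 1) (by omega)⟩

theorem nil_mem_fSmooth : [] ∈ fSmooth a b := by
  intro n hn
  induction n with
  | zero => omega
  | succ n ih =>
    rcases n with _ | n
    · exact nil_mem_fDerivable
    · exact ⟨nil_mem_fDerivable, ih (by omega)⟩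

theorem pos_append (ha : 1 ≤ a) (hab : a < b) {p q : ℕ} {m : List ℕ} (hm : m ∈ words a b)
    (hp : 1 ≤ p) (hq : 1 ≤ q) : ∀ x ∈ p :: (m ++ [q]), 1 ≤ x := by
  have := pos_of_mem_words ha hab hm
  simp only [List.mem_cons, List.mem_append, List.not_mem_nil, or_false]
  rintro x (rfl | hx | rfl)
  exacts [hp, this x hx, hq]

theorem expand_append_mem_fSmooth_iff (ha : 1 ≤ a) (hab : a < b) (hc : c = a ∨ c = b)
    {p q : ℕ} {m : List ℕ} (hm : m ∈ words a b) (hp : 1 ≤ p) (hq : 1 ≤ q) :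
    expand a b c (p :: (m ++ [q])) ∈ fSmooth a b ↔
      p ≤ b ∧ q ≤ b ∧ cut a b p ++ m ++ cut a b q ∈ fSmooth a b := by
  have h := pos_append ha hab hm hp hq
  rw [mem_fSmooth_iff, expand_append_mem_fDerivable_iff hab hc h, fDerivative_expand hab hc h,
    cutEnds_append]
  simp [hm, and_assoc]

theorem cut_of_le {p : ℕ} (h : p ≤ a) : cut a b p = [] := by simp [cut, h]

theorem cut_of_lt {p : ℕ} (h : a < p) : cut a b p = [b] := by simp [cut, h]

theorem singleton_mem_fSmooth (ha : 1 ≤ a) (hab : a < b) (hc : c = a ∨ c = b) :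
    [c] ∈ fSmooth a b := by
  have h : [c] = expand a b c [1] := by simp [expand]
  rw [h, mem_fSmooth_iff, expand_singleton_mem_fDerivable_iff hab hc le_rfl,
    fDerivative_expand hab hc (by simp)]
  refine ⟨by omega, ?_⟩
  rw [cutEnds, cut_of_le ha]
  exact nil_mem_fSmooth

theorem cut_mem_fSmooth (ha : 1 ≤ a) (hab : a < b) (p : ℕ) : cut a b p ∈ fSmooth a b := by
  unfold cut
  split
  · exact nil_mem_fSmooth
  · exact singleton_mem_fSmooth ha hab (Or.inr rfl)

theorem expand_singleton_mem_fSmooth (ha : 1 ≤ a) (hab : a < b) (hc : c = a ∨ c = b) {p : ℕ}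
    (hp : 1 ≤ p) (hpb : p ≤ b) : expand a b c [p] ∈ fSmooth a b := by
  rw [mem_fSmooth_iff, expand_singleton_mem_fDerivable_iff hab hc hp,
    fDerivative_expand hab hc (by simpa)]
  exact ⟨hpb, cut_mem_fSmooth ha hab p⟩

theorem fSmooth_subset_words {u : List ℕ} (hu : u ∈ fSmooth a b) : u ∈ words a b :=
  (hu 1 le_rfl).1

/-- Smooth words are either empty, or powers of a letter with exponent at most `b`, or have at
least two blocks; in the last case smoothness passes to the derivative. -/
theorem fSmooth_cases (ha : 1 ≤ a) (hab : a < b) {u : List ℕ} (hu : u ∈ fSmooth a b) :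
    u = [] ∨ (∃ c p, (c = a ∨ c = b) ∧ 1 ≤ p ∧ p ≤ b ∧ u = expand a b c [p]) ∨
      ∃ c p m q, (c = a ∨ c = b) ∧ m ∈ words a b ∧ (1 ≤ p ∧ p ≤ b) ∧ (1 ≤ q ∧ q ≤ b) ∧
        cut a b p ++ m ++ cut a b q ∈ fSmooth a b ∧ u = expand a b c (p :: (m ++ [q])) := by
  rcases fDerivable_cases hab (mem_fSmooth_iff.1 hu).1 with
    h | h | ⟨c, p, m, q, hc, hm, hp, hq, rfl⟩
  · exact Or.inl h
  · exact Or.inr (Or.inl h)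
  · exact Or.inr (Or.inr ⟨c, p, m, q, hc, hm, hp, hq,
      ((expand_append_mem_fSmooth_iff ha hab hc hm hp.1 hq.1).1 hu).2.2, rfl⟩)

theorem length_cut_append_lt (ha : 1 ≤ a) (hab : a < b) {p q : ℕ} {m : List ℕ}
    (hm : m ∈ words a b) (hp : 1 ≤ p) :
    (cut a b p ++ m ++ cut a b q).length < (expand a b c (p :: (m ++ [q]))).length := by
  have h1 : m.length ≤ m.sum := by
    have := List.card_nsmul_le_sum m 1 (pos_of_mem_words ha hab hm)
    simpa using this
  have h2 : (cut a b p).length < p := by unfold cut; split <;> simp <;> omega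
  have h3 := length_cut_le (b := b) (p := q) ha
  rw [length_expand]
  simp only [List.length_append, List.sum_cons, List.sum_append, List.sum_nil]
  omega

/-- Every smooth word can be prolonged to the left. A first block of length other than `a` can be
lengthened or closed without changing the derivative; if it has length `a`, the two possible letters
prepend `a` and `b` to the derivative, one of which is allowed by induction. -/
theorem exists_cons_mem_fSmooth (ha : 1 ≤ a) (hab : a < b) {u : List ℕ}
    (hu : u ∈ fSmooth a b) : ∃ x, (x = a ∨ x = b) ∧ x :: u ∈ fSmooth a b := by
  induction hn : u.length using Nat.strong_induction_on generalizing u with | _ n ih => ?_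
  subst hn
  rcases fSmooth_cases ha hab hu with rfl | ⟨c, p, hc, hp, hpb, rfl⟩ |
    ⟨c, p, m, q, hc, hm, hp, hq, hs, rfl⟩
  · exact ⟨a, Or.inl rfl, singleton_mem_fSmooth ha hab (Or.inl rfl)⟩
  · rcases hpb.lt_or_eq with h | rfl
    · exact ⟨c, hc, cons_expand p [] ▸ expand_singleton_mem_fSmooth ha hab hc (by omega) h⟩
    · refine ⟨_, otherLetter_mem hc, ?_⟩
      rw [otherLetter_cons_expand hc]
      refine (expand_append_mem_fSmooth_iff (m := []) ha hab (otherLetter_mem hc) nil_mem_words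
        le_rfl hp).2 ⟨by omega, le_rfl, ?_⟩
      rw [cut_of_le ha]
      exact cut_mem_fSmooth ha hab _
  · have key : ∀ p', 1 ≤ p' → p' ≤ b → cut a b p' ++ m ++ cut a b q ∈ fSmooth a b →
        expand a b c (p' :: (m ++ [q])) ∈ fSmooth a b := fun p' h1 h2 h3 =>
      (expand_append_mem_fSmooth_iff ha hab hc hm h1 hq.1).2 ⟨h2, hq.2, h3⟩
    have key2 : (p = a ∨ p = b) → p :: m ++ cut a b q ∈ fSmooth a b →
        otherLetter a b c :: expand a b c (p :: (m ++ [q])) ∈ fSmooth a b := fun h1 h2 => by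
      rw [otherLetter_cons_expand hc]
      refine (expand_append_mem_fSmooth_iff (m := p :: m) ha hab (otherLetter_mem hc)
        (mem_words_cons.2 ⟨h1, hm⟩) le_rfl hq.1).2 ⟨by omega, hq.2, ?_⟩
      rwa [cut_of_le ha, List.nil_append]
    rcases lt_trichotomy p a with h | rfl | h
    · refine ⟨c, hc, cons_expand p _ ▸ key _ (by omega) (by omega) ?_⟩
      rw [cut_of_le (by omega)] at hs ⊢
      exact hs
    · obtain ⟨y, hy, hys⟩ := ih _ (length_cut_append_lt ha hab hm hp.1) hs rfl
      rw [cut_of_le le_rfl] at hys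
      rcases hy with rfl | rfl
      · exact ⟨_, otherLetter_mem hc, key2 (Or.inl rfl) hys⟩
      · refine ⟨c, hc, cons_expand p _ ▸ key _ (by omega) (by omega) ?_⟩
        rw [cut_of_lt (by omega)]
        exact hys
    · rcases hp.2.lt_or_eq with h' | rfl
      · refine ⟨c, hc, cons_expand p _ ▸ key _ (by omega) (by omega) ?_⟩
        rw [cut_of_lt (by omega)] at hs ⊢
        exact hs
      · refine ⟨_, otherLetter_mem hc, key2 (Or.inr rfl) ?_⟩
        rwa [cut_of_lt h] at hs

/-! ### Left special words -/

/-- The left special words of a language over `{a, b}`: those that can be prolonged to the left by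
both letters. They need not be assumed to belong to the language. -/
def leftSpecial (a b : ℕ) (L : Set (List ℕ)) : Set (List ℕ) :=
  {u | a :: u ∈ L ∧ b :: u ∈ L}

/-- If the first block of `u` has length `a`, then continuing it and closing it turn the derivative
`u'` into `b :: u'` and `a :: u'` respectively. -/
theorem expand_append_mem_leftSpecial_iff (ha : 1 ≤ a) (hab : a < b) (hc : c = a ∨ c = b)
    {p q : ℕ} {m : List ℕ} (hm : m ∈ words a b) (hp : 1 ≤ p) (hq : 1 ≤ q) (hqb : q ≤ b) :
    expand a b c (p :: (m ++ [q])) ∈ leftSpecial a b (fSmooth a b) ↔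
      p = a ∧ m ++ cut a b q ∈ leftSpecial a b (fSmooth a b) := by
  have h1 : c :: expand a b c (p :: (m ++ [q])) ∈ fSmooth a b ↔
      p + 1 ≤ b ∧ cut a b (p + 1) ++ m ++ cut a b q ∈ fSmooth a b := by
    rw [cons_expand, expand_append_mem_fSmooth_iff ha hab hc hm (by omega) hq]
    simp [hqb]
  have h2 : otherLetter a b c :: expand a b c (p :: (m ++ [q])) ∈ fSmooth a b ↔
      (p = a ∨ p = b) ∧ p :: m ++ cut a b q ∈ fSmooth a b := by
    rw [otherLetter_cons_expand hc]
    have hpos := pos_append ha hab hm hp hq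
    constructor
    · intro h
      have hw : p :: m ∈ words a b :=
        ((expand_append_mem_fDerivable_iff (m := p :: m) hab (otherLetter_mem hc)
          (by simpa using hpos)).1 (mem_fSmooth_iff.1 h).1).1
      have := ((expand_append_mem_fSmooth_iff ha hab (otherLetter_mem hc) hw le_rfl hq).1 h).2.2
      rw [cut_of_le ha, List.nil_append] at this
      exact ⟨(mem_words_cons.1 hw).1, this⟩
    · rintro ⟨h, h'⟩
      refine (expand_append_mem_fSmooth_iff (m := p :: m) ha hab (otherLetter_mem hc)
        (mem_words_cons.2 ⟨h, hm⟩) le_rfl hq).2 ⟨by omega, hqb, ?_⟩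
      rwa [cut_of_le ha, List.nil_append]
  have h3 : expand a b c (p :: (m ++ [q])) ∈ leftSpecial a b (fSmooth a b) ↔
      c :: expand a b c (p :: (m ++ [q])) ∈ fSmooth a b ∧
      otherLetter a b c :: expand a b c (p :: (m ++ [q])) ∈ fSmooth a b := by
    rcases hc with rfl | rfl
    · simp [leftSpecial, otherLetter]
    · simp [leftSpecial, otherLetter, and_comm]
  rw [h3, h1, h2]
  constructor
  · rintro ⟨⟨h4, h5⟩, h6, h7⟩
    have hpa : p = a := by omega
    subst hpa
    rw [cut_of_lt (by omega)] at h5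
    exact ⟨rfl, h7, h5⟩
  · rintro ⟨rfl, h7, h5⟩
    refine ⟨⟨by omega, ?_⟩, Or.inl rfl, h7⟩
    rw [cut_of_lt (by omega)]
    exact h5

theorem expand_singleton_mem_leftSpecial (ha : 1 ≤ a) (hab : a < b) (hc : c = a ∨ c = b) {p : ℕ}
    (hpa : p ≤ a) : expand a b c [p] ∈ leftSpecial a b (fSmooth a b) := by
  rcases Nat.eq_zero_or_pos p with rfl | hp
  · exact ⟨singleton_mem_fSmooth ha hab (Or.inl rfl), singleton_mem_fSmooth ha hab (Or.inr rfl)⟩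
  have h1 : c :: expand a b c [p] ∈ fSmooth a b :=
    cons_expand p [] ▸ expand_singleton_mem_fSmooth ha hab hc (by omega) (by omega)
  have h2 : otherLetter a b c :: expand a b c [p] ∈ fSmooth a b := by
    rw [otherLetter_cons_expand hc]
    refine (expand_append_mem_fSmooth_iff (m := []) ha hab (otherLetter_mem hc) nil_mem_words
      le_rfl hp).2 ⟨by omega, by omega, ?_⟩
    rw [cut_of_le ha]
    exact cut_mem_fSmooth ha hab _
  rcases hc with rfl | rfl
  · exact ⟨h1, by simpa [otherLetter] using h2⟩
  · exact ⟨by simpa [otherLetter] using h2, h1⟩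

theorem reverse_mem_words {u : List ℕ} (hu : u ∈ words a b) : u.reverse ∈ words a b :=
  fun x hx => hu x (List.mem_reverse.1 hx)

theorem reverse_expand (hab : a < b) (hc : c = a ∨ c = b) {ps : List ℕ}
    (hps : ∀ p ∈ ps, 1 ≤ p) :
    ∃ c', (c' = a ∨ c' = b) ∧ (expand a b c ps).reverse = expand a b c' ps.reverse := by
  obtain ⟨c', ps', hc', hps', h⟩ := exists_eq_expand (reverse_mem_words (expand_mem_words hc ps))
  have := runLengths_reverse_expand hab hc hps
  rw [h, runLengths_expand hab hc' hps'] at this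
  exact ⟨c', hc', this ▸ h⟩

/-! ### A left extendable tree of right special words -/

/-- A family of words whose reversals are left special: the words whose last block, and that of
each of their iterated derivatives with at least two blocks, has length `a`, and whose derivatives
reach a power `c ^ p` with `p ≤ a` (the power with `p = 0` being the empty word). The powers with
`a < p < b` are also special, but prolonging them to the left within the
special words ends after finitely many steps, so they are left out. -/
inductive SpecialTree (a b : ℕ) : List ℕ → Prop
  | power {c p : ℕ} (hc : c = a ∨ c = b) (hp : p ≤ a) : SpecialTree a b (expand a b c [p])
  | lift {c p : ℕ} {m : List ℕ} (hc : c = a ∨ c = b) (hm : m ∈ words a b) (hp : 1 ≤ p)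
      (hpb : p ≤ b) (h : SpecialTree a b (cut a b p ++ m)) :
      SpecialTree a b (expand a b c (p :: (m ++ [a])))

theorem SpecialTree.mem_words {u : List ℕ} (h : SpecialTree a b u) : u ∈ words a b := by
  cases h with
  | power hc => exact expand_mem_words hc _
  | lift hc => exact expand_mem_words hc _

theorem SpecialTree.nil : SpecialTree a b [] :=
  SpecialTree.power (c := a) (p := 0) (Or.inl rfl) (Nat.zero_le a)

theorem SpecialTree.exists_cons (ha : 1 ≤ a) (hab : a < b) {u : List ℕ}
    (h : SpecialTree a b u) : ∃ x, (x = a ∨ x = b) ∧ SpecialTree a b (x :: u) := by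
  -- Closing the first block adds its length to the front of the derivative, the new block `1`
  -- being cut.
  have close : ∀ {c p : ℕ} {m : List ℕ}, (c = a ∨ c = b) → p :: m ∈ words a b →
      SpecialTree a b (p :: m) →
      SpecialTree a b (otherLetter a b c :: expand a b c (p :: (m ++ [a]))) := by
    intro c p m hc hm h
    rw [otherLetter_cons_expand hc]
    refine SpecialTree.lift (m := p :: m) (otherLetter_mem hc) hm le_rfl (by omega) ?_
    rwa [cut_of_le ha]
  induction h with
  | @power c p hc hp =>
    rcases hp.lt_or_eq with h | rfl
    · exact ⟨c, hc, cons_expand p [] ▸ SpecialTree.power hc h⟩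
    · refine ⟨_, otherLetter_mem hc, ?_⟩
      rw [otherLetter_cons_expand hc]
      refine SpecialTree.lift (m := []) (otherLetter_mem hc) nil_mem_words le_rfl (by omega) ?_
      rw [cut_of_le ha]
      exact SpecialTree.nil
  | @lift c p m hc hm hp hpb h ih =>
    rcases lt_trichotomy p a with h' | rfl | h'
    · refine ⟨c, hc, cons_expand p _ ▸ SpecialTree.lift hc hm (by omega) (by omega) ?_⟩
      rw [cut_of_le (by omega)] at h ⊢
      exact h
    · obtain ⟨y, hy, hys⟩ := ih
      rw [cut_of_le le_rfl] at hys
      rcases hy with rfl | rfl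
      · exact ⟨_, otherLetter_mem hc, close hc hys.mem_words hys⟩
      · refine ⟨c, hc, cons_expand p _ ▸ SpecialTree.lift hc hm (by omega) (by omega) ?_⟩
        rw [cut_of_lt (by omega)]
        exact hys
    · rw [cut_of_lt h'] at h
      rcases hpb.lt_or_eq with h'' | rfl
      · refine ⟨c, hc, cons_expand p _ ▸ SpecialTree.lift hc hm (by omega) (by omega) ?_⟩
        rw [cut_of_lt (by omega)]
        exact h
      · exact ⟨_, otherLetter_mem hc, close hc h.mem_words h⟩

theorem SpecialTree.reverse_mem_leftSpecial (ha : 1 ≤ a) (hab : a < b) {u : List ℕ}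
    (h : SpecialTree a b u) : u.reverse ∈ leftSpecial a b (fSmooth a b) := by
  induction h with
  | @power c p hc hp =>
    have := expand_singleton_mem_leftSpecial ha hab hc hp
    simpa [expand] using this
  | @lift c p m hc hm hp hpb h ih =>
    obtain ⟨c', hc', h'⟩ := reverse_expand hab hc (pos_append ha hab hm hp ha)
    have h2 : (p :: (m ++ [a])).reverse = a :: (m.reverse ++ [p]) := by simp
    rw [h', h2, expand_append_mem_leftSpecial_iff ha hab hc' (reverse_mem_words hm) ha hp hpb]
    rw [List.reverse_append, reverse_cut] at ih
    exact ⟨rfl, ih⟩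

/-! ### The bispecial words descending from the empty word -/

/-- The words obtained from the empty word by `k` liftings, each replacing a word `w` by the word with
runs `a, w₁, …, wₙ, a`, for both choices of the first letter. -/
def bispecialLevel (a b : ℕ) : ℕ → Finset (List ℕ)
  | 0 => {[]}
  | k + 1 => (bispecialLevel a b k).image (fun w => expand a b a (a :: (w ++ [a]))) ∪
      (bispecialLevel a b k).image (fun w => expand a b b (a :: (w ++ [a])))

theorem bispecialLevel_mem_words {k : ℕ} {z : List ℕ} (hz : z ∈ bispecialLevel a b k) :
    z ∈ words a b := by
  cases k with
  | zero => simp_all [bispecialLevel, nil_mem_words]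
  | succ k =>
    simp only [bispecialLevel, Finset.mem_union, Finset.mem_image] at hz
    rcases hz with ⟨w, -, rfl⟩ | ⟨w, -, rfl⟩
    · exact expand_mem_words (Or.inl rfl) _
    · exact expand_mem_words (Or.inr rfl) _

theorem bispecialLevel_subset_leftSpecial (ha : 1 ≤ a) (hab : a < b) {k : ℕ} {z : List ℕ}
    (hz : z ∈ bispecialLevel a b k) : z ∈ leftSpecial a b {u | SpecialTree a b u} := by
  induction k generalizing z with
  | zero =>
    obtain rfl : z = [] := by simpa [bispecialLevel] using hz
    have : ∀ c, (c = a ∨ c = b) → SpecialTree a b [c] := fun c hc => by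
      simpa [expand] using SpecialTree.power (p := 1) hc ha
    exact ⟨this a (Or.inl rfl), this b (Or.inr rfl)⟩
  | succ k ih =>
    have key : ∀ c, (c = a ∨ c = b) → ∀ w ∈ bispecialLevel a b k,
        SpecialTree a b (c :: expand a b c (a :: (w ++ [a]))) ∧
        SpecialTree a b (otherLetter a b c :: expand a b c (a :: (w ++ [a]))) := by
      intro c hc w hw
      obtain ⟨h1, h2⟩ := ih hw
      have hw' := bispecialLevel_mem_words hw
      constructor
      · rw [cons_expand]
        refine SpecialTree.lift hc hw' (by omega) (by omega) ?_
        rw [cut_of_lt (by omega)]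
        exact h2
      · rw [otherLetter_cons_expand hc]
        refine SpecialTree.lift (m := a :: w) (otherLetter_mem hc)
          (mem_words_cons.2 ⟨Or.inl rfl, hw'⟩) le_rfl (by omega) ?_
        rw [cut_of_le ha]
        exact h1
    simp only [bispecialLevel, Finset.mem_union, Finset.mem_image] at hz
    rcases hz with ⟨w, hw, rfl⟩ | ⟨w, hw, rfl⟩
    · have := key a (Or.inl rfl) w hw
      simpa [leftSpecial, otherLetter] using this
    · have := key b (Or.inr rfl) w hw
      simpa [leftSpecial, otherLetter, and_comm] using this

theorem expand_injOn (ha : 1 ≤ a) (hab : a < b) (hc : c = a ∨ c = b) (k : ℕ) :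
    Set.InjOn (fun w => expand a b c (a :: (w ++ [a]))) (bispecialLevel a b k) := by
  intro w hw w' hw' h
  have h1 := pos_append ha hab (bispecialLevel_mem_words hw) ha ha
  have h2 := pos_append ha hab (bispecialLevel_mem_words hw') ha ha
  have := congrArg runLengths h
  simp only [runLengths_expand hab hc h1, runLengths_expand hab hc h2] at this
  simpa using this

theorem sum_bispecialLevel_succ (ha : 1 ≤ a) (hab : a < b) (k : ℕ) (f : List ℕ → ℕ) :
    ∑ z ∈ bispecialLevel a b (k + 1), f z = ∑ w ∈ bispecialLevel a b k,
      (f (expand a b a (a :: (w ++ [a]))) + f (expand a b b (a :: (w ++ [a])))) := by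
  rw [bispecialLevel, Finset.sum_union, Finset.sum_image (expand_injOn ha hab (Or.inl rfl) k),
    Finset.sum_image (expand_injOn ha hab (Or.inr rfl) k), Finset.sum_add_distrib]
  rw [Finset.disjoint_left]
  intro z hz hz'
  obtain ⟨w, -, rfl⟩ := Finset.mem_image.1 hz
  obtain ⟨w', -, h⟩ := Finset.mem_image.1 hz'
  have := congrArg List.head? h
  rw [head?_expand ha, head?_expand ha, Option.some.injEq] at this
  omega

theorem card_bispecialLevel (ha : 1 ≤ a) (hab : a < b) (k : ℕ) :
    (bispecialLevel a b k).card = 2 ^ k := by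
  induction k with
  | zero => rfl
  | succ k ih =>
    rw [Finset.card_eq_sum_ones, sum_bispecialLevel_succ ha hab, Finset.sum_const, ih, pow_succ]
    rfl

/-- The two expansions of the same runs are complementary, so their letters add up to `a + b` at
each position. -/
theorem sum_expand_add (hc : c = a ∨ c = b) (ps : List ℕ) :
    (expand a b c ps).sum + (expand a b (otherLetter a b c) ps).sum = (a + b) * ps.sum := by
  induction ps generalizing c with
  | nil => rfl
  | cons p ps ih =>
    have h := ih (otherLetter_mem hc)
    have h' : c + otherLetter a b c = a + b := by unfold otherLetter; omega
    simp only [expand, List.sum_append, List.sum_replicate, smul_eq_mul, List.sum_cons]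
    rw [mul_add, ← h, ← h']
    ring

/-- The mean letter sum of the words of level `k` is `O(((a + b) / 2) ^ k)`. -/
theorem sum_bispecialLevel_le (ha : 1 ≤ a) (hab : a < b) (k : ℕ) :
    ∑ z ∈ bispecialLevel a b k, z.sum + 2 * a * (a + b) * 2 ^ k ≤
      2 * a * (a + b) * (a + b) ^ k := by
  induction k with
  | zero => simp [bispecialLevel]
  | succ k ih =>
    have h : ∀ w : List ℕ, (expand a b a (a :: (w ++ [a]))).sum +
        (expand a b b (a :: (w ++ [a]))).sum = (a + b) * w.sum + (a + b) * (2 * a) := by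
      intro w
      have := sum_expand_add (a := a) (b := b) (Or.inl rfl) (a :: (w ++ [a]))
      rw [show otherLetter a b a = b by simp [otherLetter]] at this
      rw [this]
      simp only [List.sum_cons, List.sum_append, List.sum_nil]
      ring
    rw [sum_bispecialLevel_succ ha hab, Finset.sum_congr rfl fun w _ => h w,
      Finset.sum_add_distrib, ← Finset.mul_sum, Finset.sum_const, card_bispecialLevel ha hab,
      smul_eq_mul]
    -- This is where `a + b ≥ 3` is needed: the lifting adds `2 * a` to the mean at each level.
    have h3 : 3 * (2 * a * (a + b) * 2 ^ k) ≤ (a + b) * (2 * a * (a + b) * 2 ^ k) :=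
      Nat.mul_le_mul_right _ (by omega)
    have h4 := Nat.mul_le_mul_left (a + b) ih
    rw [pow_succ, pow_succ]
    nlinarith

theorem length_le_sum (ha : 1 ≤ a) (hab : a < b) {m : List ℕ} (hm : m ∈ words a b) :
    m.length ≤ m.sum := by
  simpa using List.card_nsmul_le_sum m 1 (pos_of_mem_words ha hab hm)

/-- By Markov's inequality, at least half of the words of level `k` have length at most twice the
bound on the mean. -/
theorem two_pow_le_card_filter (ha : 1 ≤ a) (hab : a < b) {k M : ℕ}
    (hM : 4 * a * (a + b) * (a + b) ^ k ≤ M * 2 ^ k) :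
    2 ^ k ≤ 2 * ((bispecialLevel a b k).filter fun z => z.length < M).card := by
  have h1 := Finset.card_filter_add_card_filter_not (s := bispecialLevel a b k)
    (fun z : List ℕ => z.length < M)
  rw [card_bispecialLevel ha hab] at h1
  have h2 : ((bispecialLevel a b k).filter fun z => ¬ z.length < M).card * M ≤
      ∑ z ∈ bispecialLevel a b k, z.sum := by
    refine le_trans ?_ (Finset.sum_le_sum_of_subset
      (Finset.filter_subset (fun z => ¬ z.length < M) _))
    rw [← smul_eq_mul]
    refine Finset.card_nsmul_le_sum _ _ _ fun z hz => ?_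
    rw [Finset.mem_filter, not_lt] at hz
    exact hz.2.trans (length_le_sum ha hab (bispecialLevel_mem_words hz.1))
  have h3 := sum_bispecialLevel_le ha hab k
  have hMpos : 0 < M := by
    rcases Nat.eq_zero_or_pos M with rfl | h
    · have : 0 < 4 * a * (a + b) * (a + b) ^ k := by positivity
      omega
    · exact h
  have h4 : 2 * ((bispecialLevel a b k).filter fun z => ¬ z.length < M).card ≤ 2 ^ k := by
    refine Nat.le_of_mul_le_mul_right ?_ hMpos
    have : 0 ≤ 2 * a * (a + b) * 2 ^ k := Nat.zero_le _
    nlinarith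
  omega

/-! ### Counting words by left extensions -/

theorem finite_words_length (a b n : ℕ) : {u | u ∈ words a b ∧ u.length = n}.Finite := by
  induction n with
  | zero => exact (Set.finite_singleton []).subset fun u hu => by simpa using hu.2
  | succ n ih =>
    refine ((ih.image (List.cons a)).union (ih.image (List.cons b))).subset ?_
    rintro (_ | ⟨x, u⟩) ⟨h1, h2⟩
    · simp at h2
    · rw [mem_words_cons] at h1
      have h3 : u.length = n := by simpa using h2
      rcases h1.1 with rfl | rfl
      · exact Or.inl ⟨u, ⟨h1.2, h3⟩, rfl⟩
      · exact Or.inr ⟨u, ⟨h1.2, h3⟩, rfl⟩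

theorem finite_slice {L : Set (List ℕ)} (hL : L ⊆ words a b) (n : ℕ) :
    {u | u ∈ L ∧ u.length = n}.Finite :=
  (finite_words_length a b n).subset fun _ hu => ⟨hL hu.1, hu.2⟩

theorem complexity_succ (hab : a < b) {L : Set (List ℕ)} (hL : L ⊆ words a b) (n : ℕ) :
    complexity L (n + 1) =
      {u | (a :: u ∈ L ∨ b :: u ∈ L) ∧ u.length = n}.ncard + complexity (leftSpecial a b L) n := by
  have hfin : ∀ x, {u | x :: u ∈ L ∧ u.length = n}.Finite := fun x =>
    (finite_words_length a b n).subset fun u hu => ⟨(mem_words_cons.1 (hL hu.1)).2, hu.2⟩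
  have h1 : {u | u ∈ L ∧ u.length = n + 1} =
      List.cons a '' {u | a :: u ∈ L ∧ u.length = n} ∪
        List.cons b '' {u | b :: u ∈ L ∧ u.length = n} := by
    ext u
    rcases u with _ | ⟨x, u⟩
    · simp
    · constructor
      · rintro ⟨h, h'⟩
        have h3 : u.length = n := by simpa using h'
        rcases (mem_words_cons.1 (hL h)).1 with rfl | rfl
        · exact Or.inl ⟨u, ⟨h, h3⟩, rfl⟩
        · exact Or.inr ⟨u, ⟨h, h3⟩, rfl⟩
      · rintro (⟨v, ⟨h, h'⟩, h2⟩ | ⟨v, ⟨h, h'⟩, h2⟩) <;> rw [← h2] <;> exact ⟨h, by simp [h']⟩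
  have hdisj : Disjoint (List.cons a '' {u | a :: u ∈ L ∧ u.length = n})
      (List.cons b '' {u | b :: u ∈ L ∧ u.length = n}) := by
    rw [Set.disjoint_left]
    rintro _ ⟨v, -, rfl⟩ ⟨w, -, h⟩
    have := (List.cons.inj h).1
    omega
  rw [complexity, h1, Set.ncard_union_eq hdisj ((hfin a).image _) ((hfin b).image _),
    Set.ncard_image_of_injective _ List.cons_injective,
    Set.ncard_image_of_injective _ List.cons_injective,
    ← Set.ncard_union_add_ncard_inter _ _ (hfin a) (hfin b), complexity]
  congr 2
  · ext u
    simp only [Set.mem_union, Set.mem_ofPred_eq]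
    tauto
  · ext u
    simp only [Set.mem_inter_iff, Set.mem_ofPred_eq, leftSpecial]
    tauto

theorem complexity_add_le (hab : a < b) {L S : Set (List ℕ)} (hL : L ⊆ words a b)
    (hext : ∀ u ∈ L, ∃ x, (x = a ∨ x = b) ∧ x :: u ∈ L) (hS : S ⊆ leftSpecial a b L) (n : ℕ) :
    complexity L n + complexity S n ≤ complexity L (n + 1) := by
  rw [complexity_succ hab hL]
  refine Nat.add_le_add (Set.ncard_le_ncard ?_ ?_) (Set.ncard_le_ncard ?_ ?_)
  · rintro u ⟨hu, hn⟩
    obtain ⟨x, rfl | rfl, hx⟩ := hext u hu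
    · exact ⟨Or.inl hx, hn⟩
    · exact ⟨Or.inr hx, hn⟩
  · refine (finite_words_length a b n).subset ?_
    rintro u ⟨h | h, hn⟩
    · exact ⟨(mem_words_cons.1 (hL h)).2, hn⟩
    · exact ⟨(mem_words_cons.1 (hL h)).2, hn⟩
  · exact fun u hu => ⟨hS hu.1, hu.2⟩
  · exact finite_slice (fun u hu => (mem_words_cons.1 (hL hu.1)).2) n

theorem leftSpecial_subset_words {L : Set (List ℕ)} (hL : L ⊆ words a b) :
    leftSpecial a b L ⊆ words a b :=
  fun _ hu => (mem_words_cons.1 (hL hu.1)).2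

theorem complexity_reverse_le {L M : Set (List ℕ)} (hM : M ⊆ words a b)
    (h : ∀ u ∈ L, u.reverse ∈ M) (n : ℕ) : complexity L n ≤ complexity M n :=
  Set.ncard_le_ncard_of_injOn List.reverse (fun u hu => ⟨h u hu.1, by simpa using hu.2⟩)
    List.reverse_injective.injOn (finite_slice hM n)

theorem card_filter_le_complexity (ha : 1 ≤ a) (hab : a < b) (k n : ℕ) :
    ((bispecialLevel a b k).filter fun z => z.length < n).card ≤
      complexity {u | SpecialTree a b u} n := by
  induction n with
  | zero => simp
  | succ n ih =>
    have h1 := complexity_add_le (L := {u | SpecialTree a b u}) (S := bispecialLevel a b k) hab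
      (fun u hu => SpecialTree.mem_words hu) (fun u hu => SpecialTree.exists_cons ha hab hu)
      (fun u hu => bispecialLevel_subset_leftSpecial ha hab hu) n
    have h2 : complexity (bispecialLevel a b k : Set (List ℕ)) n =
        ((bispecialLevel a b k).filter fun z => z.length = n).card := by
      rw [complexity, ← Set.ncard_coe_finset]
      congr 1
      ext u
      simp
    have h3 : ((bispecialLevel a b k).filter fun z => z.length < n + 1) =
        ((bispecialLevel a b k).filter fun z => z.length < n) ∪
        ((bispecialLevel a b k).filter fun z => z.length = n) := by
      ext u
      simp only [Finset.mem_filter, Finset.mem_union]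
      have : u.length < n + 1 ↔ u.length < n ∨ u.length = n := by omega
      tauto
    rw [h3]
    exact (Finset.card_union_le _ _).trans (by omega)

theorem complexity_fSmooth_add_le (ha : 1 ≤ a) (hab : a < b) (n : ℕ) :
    complexity (fSmooth a b) n + complexity {u | SpecialTree a b u} n ≤
      complexity (fSmooth a b) (n + 1) := by
  have h1 := complexity_add_le (L := fSmooth a b) hab (fun u => fSmooth_subset_words)
    (fun u => exists_cons_mem_fSmooth ha hab) le_rfl n
  have h2 := complexity_reverse_le (L := {u | SpecialTree a b u})
    (leftSpecial_subset_words fun u => fSmooth_subset_words)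
    (fun u hu => SpecialTree.reverse_mem_leftSpecial ha hab hu) n
  omega

theorem mul_card_filter_le_complexity (ha : 1 ≤ a) (hab : a < b) (k m i : ℕ) :
    i * ((bispecialLevel a b k).filter fun z => z.length < m).card ≤
      complexity (fSmooth a b) (m + i) := by
  induction i with
  | zero => simp
  | succ i ih =>
    have h1 := complexity_fSmooth_add_le ha hab (m + i)
    have h2 := card_filter_le_complexity ha hab k (m + i)
    have h3 : ((bispecialLevel a b k).filter fun z => z.length < m).card ≤
        ((bispecialLevel a b k).filter fun z => z.length < m + i).card :=
      Finset.card_le_card fun z hz => by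
        simp only [Finset.mem_filter] at hz ⊢
        exact ⟨hz.1, by omega⟩
    rw [add_mul, one_mul, ← add_assoc]
    omega

/-- The combinatorial lower bound: `2 ^ k` special words of length about `((a + b) / 2) ^ k`
contribute at each longer length. -/
theorem mul_two_pow_le_complexity (ha : 1 ≤ a) (hab : a < b) {k m n : ℕ}
    (hm : 4 * a * (a + b) * (a + b) ^ k ≤ m * 2 ^ k) (hn : 2 * m ≤ n) :
    m * 2 ^ k ≤ 2 * complexity (fSmooth a b) n := by
  have h1 := two_pow_le_card_filter ha hab hm
  have h2 := mul_card_filter_le_complexity ha hab k m (n - m)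
  rw [show m + (n - m) = n by omega] at h2
  have h3 := Nat.mul_le_mul_right
    ((bispecialLevel a b k).filter fun z => z.length < m).card (show m ≤ n - m by omega)
  have h4 := Nat.mul_le_mul_left m h1
  nlinarith

/-! ### The growth of the number of smooth words: lower bound -/

/-- The exponent `ρ` is defined by `((a + b) / 2) ^ ρ = a + b`. -/
theorem rpow_exponent {ρ : ℝ} (ha : 1 ≤ a) (hab : a < b)
    (hρ : ρ = Real.log ((a : ℝ) + (b : ℝ)) / Real.log (((a : ℝ) + (b : ℝ)) / 2)) :
    1 < ((a : ℝ) + b) / 2 ∧ 0 ≤ ρ ∧ ∀ k : ℕ, ((((a : ℝ) + b) / 2) ^ k) ^ ρ = ((a : ℝ) + b) ^ k := by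
  have ha' : (1 : ℝ) ≤ a := by exact_mod_cast ha
  have hab' : (a : ℝ) + 1 ≤ b := by exact_mod_cast hab
  have h1 : 1 < ((a : ℝ) + b) / 2 := by linarith
  have hlog : 0 < Real.log (((a : ℝ) + b) / 2) := Real.log_pos h1
  refine ⟨h1, hρ ▸ div_nonneg (Real.log_nonneg (by linarith)) hlog.le, fun k => ?_⟩
  have h2 : (((a : ℝ) + b) / 2) ^ ρ = (a : ℝ) + b := by
    rw [Real.rpow_def_of_pos (by linarith), hρ, mul_div_cancel₀ _ hlog.ne',
      Real.exp_log (by linarith)]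
  rw [← Real.rpow_natCast, ← Real.rpow_mul (by linarith), mul_comm, Real.rpow_mul (by linarith), h2,
    Real.rpow_natCast]

theorem rpow_isBigO_complexity {ρ : ℝ} (ha : 1 ≤ a) (hab : a < b)
    (hρ : ρ = Real.log ((a : ℝ) + (b : ℝ)) / Real.log (((a : ℝ) + (b : ℝ)) / 2)) :
    (fun n : ℕ => (n : ℝ) ^ ρ) =O[atTop] fun n : ℕ => (complexity (fSmooth a b) n : ℝ) := by
  obtain ⟨hl, hρ0, hpow⟩ := rpow_exponent ha hab hρ
  set E : ℕ := 4 * a * (a + b) with hE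
  have hE1 : 1 ≤ E := Nat.one_le_iff_ne_zero.2 (by positivity)
  have hE1' : (1 : ℝ) ≤ E := by exact_mod_cast hE1
  refine IsBigO.of_bound ((3 * E) ^ ρ * (a + b) * 2) ?_
  filter_upwards [eventually_ge_atTop (2 * E)] with n hn
  -- Special words of length below `m` contribute at all the lengths from `m` to `2 * m ≤ n`;
  -- `k` is the largest level whose words mostly have length below `m`.
  obtain ⟨m, hm⟩ : ∃ m, m = n / 2 := ⟨_, rfl⟩
  have hEm : (E : ℝ) ≤ m := by
    have : E ≤ m := by omega
    exact_mod_cast this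
  have hn3 : (n : ℝ) ≤ 3 * m := by
    have : n ≤ 3 * m := by omega
    exact_mod_cast this
  obtain ⟨k, hk1, hk2⟩ := exists_nat_pow_near (x := (m : ℝ) / E) (y := ((a : ℝ) + b) / 2)
    ((one_le_div (by linarith)).2 hEm) hl
  rw [le_div_iff₀ (by linarith)] at hk1
  rw [div_lt_iff₀ (by linarith)] at hk2
  have hsplit : ((a : ℝ) + b) ^ k = (((a : ℝ) + b) / 2) ^ k * 2 ^ k := by
    rw [← mul_pow]; congr 1; ring
  have hmain : m * 2 ^ k ≤ 2 * complexity (fSmooth a b) n := by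
    refine mul_two_pow_le_complexity ha hab ?_ (by omega)
    rw [← hE]
    have : (E : ℝ) * (a + b) ^ k ≤ m * 2 ^ k := by
      rw [hsplit]
      have := mul_le_mul_of_nonneg_right hk1 (show (0 : ℝ) ≤ 2 ^ k by positivity)
      linarith
    exact_mod_cast this
  have hmain' : (m : ℝ) * 2 ^ k ≤ 2 * complexity (fSmooth a b) n := by exact_mod_cast hmain
  have h1 : (n : ℝ) ^ ρ ≤ (3 * E) ^ ρ * ((a : ℝ) + b) ^ (k + 1) := by
    rw [← hpow, ← Real.mul_rpow (by positivity) (by positivity)]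
    exact Real.rpow_le_rpow (by positivity) (by linarith) hρ0
  have h2 : ((a : ℝ) + b) ^ (k + 1) ≤ (a + b) * (2 * complexity (fSmooth a b) n) := by
    rw [pow_succ, mul_comm, hsplit]
    refine mul_le_mul_of_nonneg_left (le_trans ?_ hmain') (by positivity)
    refine mul_le_mul_of_nonneg_right (le_trans ?_ hk1) (by positivity)
    exact le_mul_of_one_le_right (by positivity) hE1'
  rw [Real.norm_of_nonneg (by positivity), Real.norm_of_nonneg (by positivity)]
  calc (n : ℝ) ^ ρ ≤ (3 * E) ^ ρ * ((a : ℝ) + b) ^ (k + 1) := h1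
    _ ≤ (3 * E) ^ ρ * ((a + b) * (2 * complexity (fSmooth a b) n)) :=
        mul_le_mul_of_nonneg_left h2 (by positivity)
    _ = _ := by ring

/-! ### All right special words -/

/-- Smoothness passes to suffixes. -/
theorem tail_mem_fSmooth (ha : 1 ≤ a) (hab : a < b) {x : ℕ} {u : List ℕ}
    (hu : x :: u ∈ fSmooth a b) : u ∈ fSmooth a b := by
  induction hn : u.length using Nat.strong_induction_on generalizing x u with | _ n ih => ?_
  subst hn
  obtain ⟨hx, hw⟩ := mem_words_cons.1 (fSmooth_subset_words hu)
  obtain ⟨c, ps, hc, hps, rfl⟩ := exists_eq_expand hw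
  rcases eq_nil_or_singleton_or_append ps with rfl | ⟨p, rfl⟩ | ⟨p, m, q, rfl⟩
  · exact nil_mem_fSmooth
  · have hp : 1 ≤ p := hps p (by simp)
    refine expand_singleton_mem_fSmooth ha hab hc hp ?_
    have hd := (mem_fSmooth_iff.1 hu).1
    rcases eq_or_eq_otherLetter hc hx with rfl | rfl
    · rw [cons_expand, expand_singleton_mem_fDerivable_iff hab hc (by omega)] at hd
      omega
    · rw [otherLetter_cons_expand hc] at hd
      exact ((expand_append_mem_fDerivable_iff (m := []) hab (otherLetter_mem hc)
        (by simpa using hps)).1 hd).2.2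
  · have hp : 1 ≤ p := hps p (by simp)
    have hq : 1 ≤ q := hps q (by simp)
    have step : ∀ y, m ∈ words a b → y :: (m ++ cut a b q) ∈ fSmooth a b →
        m ++ cut a b q ∈ fSmooth a b := by
      intro y hm h
      refine ih _ ?_ h rfl
      have := length_cut_append_lt (c := c) (q := q) ha hab hm hp
      simp only [List.length_append] at this ⊢
      omega
    have hd := (mem_fSmooth_iff.1 hu).1
    rcases eq_or_eq_otherLetter hc hx with rfl | rfl
    · rw [cons_expand] at hu hd
      have hpos : ∀ z ∈ (p + 1) :: (m ++ [q]), 1 ≤ z := by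
        rw [List.forall_mem_cons] at hps ⊢
        exact ⟨by omega, hps.2⟩
      have hm := ((expand_append_mem_fDerivable_iff hab hc hpos).1 hd).1
      obtain ⟨h1, h2, h3⟩ := (expand_append_mem_fSmooth_iff ha hab hc hm (by omega) hq).1 hu
      refine (expand_append_mem_fSmooth_iff ha hab hc hm hp hq).2 ⟨by omega, h2, ?_⟩
      rcases lt_trichotomy p a with h | rfl | h
      · rw [cut_of_le (by omega)] at h3 ⊢
        exact h3
      · rw [cut_of_lt (by omega)] at h3
        rw [cut_of_le le_rfl]
        exact step b hm h3
      · rw [cut_of_lt (by omega)] at h3 ⊢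
        exact h3
    · rw [otherLetter_cons_expand hc] at hu hd
      have hm := ((expand_append_mem_fDerivable_iff (m := p :: m) hab (otherLetter_mem hc)
        (by simpa using hps)).1 hd).1
      obtain ⟨-, h2, h3⟩ := (expand_append_mem_fSmooth_iff (m := p :: m) ha hab
        (otherLetter_mem hc) hm le_rfl hq).1 hu
      rw [mem_words_cons] at hm
      refine (expand_append_mem_fSmooth_iff ha hab hc hm.2 hp hq).2 ⟨by omega, h2, ?_⟩
      rw [cut_of_le ha, List.nil_append] at h3
      rcases hm.1 with rfl | rfl
      · rw [cut_of_le le_rfl]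
        exact step p hm.2 h3
      · rw [cut_of_lt hab]
        exact h3

/-- The mirror images of the left special smooth words: a word of at least two blocks among them has
its last block of length `a`, while its first block is only constrained by its derivative. -/
def mirrorSpecial (a b : ℕ) : Set (List ℕ) :=
  {u | u.reverse ∈ leftSpecial a b (fSmooth a b)}

theorem reverse_mem_fSmooth_of_mirrorSpecial (ha : 1 ≤ a) (hab : a < b) {u : List ℕ}
    (hu : u ∈ mirrorSpecial a b) : u.reverse ∈ fSmooth a b :=
  tail_mem_fSmooth ha hab hu.1

theorem mirrorSpecial_subset_words : mirrorSpecial a b ⊆ words a b := fun u hu =>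
  u.reverse_reverse ▸
    reverse_mem_words (leftSpecial_subset_words (fun _ => fSmooth_subset_words) hu)

theorem mirrorSpecial_cases (ha : 1 ≤ a) (hab : a < b) {u : List ℕ} (hu : u ∈ mirrorSpecial a b) :
    (∃ c p, (c = a ∨ c = b) ∧ p ≤ b ∧ u = expand a b c [p]) ∨
      ∃ c p m, (c = a ∨ c = b) ∧ m ∈ words a b ∧ (1 ≤ p ∧ p ≤ b) ∧
        cut a b p ++ m ∈ mirrorSpecial a b ∧ u = expand a b c (p :: (m ++ [a])) := by
  rcases fSmooth_cases ha hab (reverse_mem_fSmooth_of_mirrorSpecial ha hab hu) with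
    h | ⟨c, p, hc, hp, hpb, h⟩ | ⟨c, p, m, q, hc, hm, hp, hq, hs, h⟩
  · refine Or.inl ⟨a, 0, Or.inl rfl, by omega, ?_⟩
    simpa [expand] using h
  · refine Or.inl ⟨c, p, hc, hpb, ?_⟩
    rw [List.reverse_eq_iff] at h
    simpa [expand] using h
  · right
    have hu' : u.reverse ∈ leftSpecial a b (fSmooth a b) := hu
    rw [h, expand_append_mem_leftSpecial_iff ha hab hc hm hp.1 hq.1 hq.2] at hu'
    obtain ⟨rfl, hls⟩ := hu'
    obtain ⟨c', hc', h'⟩ := reverse_expand hab hc (pos_append ha hab hm hp.1 hq.1)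
    refine ⟨c', q, m.reverse, hc', reverse_mem_words hm, hq, ?_, ?_⟩
    · simpa [mirrorSpecial, reverse_cut] using hls
    · rw [List.reverse_eq_iff] at h
      rw [h, h']
      simp

theorem complexity_fSmooth_le (ha : 1 ≤ a) (hab : a < b) (n : ℕ) :
    complexity (fSmooth a b) n ≤ 1 + {u | u ∈ mirrorSpecial a b ∧ u.length < n}.ncard := by
  have hfin : ∀ n, {u | u ∈ mirrorSpecial a b ∧ u.length < n}.Finite := fun n => by
    refine ((Set.finite_lt_nat n).biUnion fun i _ => finite_words_length a b i).subset ?_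
    intro u hu
    simp only [Set.mem_iUnion]
    exact ⟨u.length, hu.2, mirrorSpecial_subset_words hu.1, rfl⟩
  induction n with
  | zero =>
    refine le_trans (Set.ncard_le_ncard (t := {[]}) (fun u hu => ?_)) (by simp)
    simpa using hu.2
  | succ n ih =>
    rw [complexity_succ hab (fun u => fSmooth_subset_words)]
    have h1 : {u | (a :: u ∈ fSmooth a b ∨ b :: u ∈ fSmooth a b) ∧ u.length = n}.ncard ≤
        complexity (fSmooth a b) n := by
      refine Set.ncard_le_ncard ?_ (finite_slice (fun u => fSmooth_subset_words) n)
      rintro u ⟨h | h, hn⟩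
      · exact ⟨tail_mem_fSmooth ha hab h, hn⟩
      · exact ⟨tail_mem_fSmooth ha hab h, hn⟩
    have h2 : complexity (leftSpecial a b (fSmooth a b)) n ≤ complexity (mirrorSpecial a b) n :=
      complexity_reverse_le mirrorSpecial_subset_words
        (fun u hu => by simpa [mirrorSpecial] using hu) n
    have h3 : {u | u ∈ mirrorSpecial a b ∧ u.length < n + 1} =
        {u | u ∈ mirrorSpecial a b ∧ u.length < n} ∪
          {u | u ∈ mirrorSpecial a b ∧ u.length = n} := by
      ext u
      simp only [Set.mem_union, Set.mem_ofPred_eq, Nat.lt_succ_iff_lt_or_eq]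
      tauto
    rw [h3, Set.ncard_union_eq _ (hfin n) (finite_slice mirrorSpecial_subset_words n)]
    · have h4 : {u | u ∈ mirrorSpecial a b ∧ u.length = n}.ncard =
        complexity (mirrorSpecial a b) n := rfl
      omega
    · rw [Set.disjoint_left]
      rintro u ⟨-, h⟩ ⟨-, h'⟩
      omega

/-! ### Balance of smooth words over an even alphabet -/

/-- The alternating sum `p₁ - p₂ + p₃ - ⋯`. -/
def alternating : List ℕ → ℤ
  | [] => 0
  | p :: ps => p - alternating ps

theorem alternating_append (l l' : List ℕ) :
    alternating (l ++ l') = alternating l + alternating l' ∨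
      alternating (l ++ l') = alternating l - alternating l' := by
  induction l with
  | nil => simp [alternating]
  | cons p l ih =>
    simp only [List.cons_append, alternating]
    omega

theorem alternating_replicate (p c : ℕ) :
    alternating (List.replicate p c) = 0 ∨ alternating (List.replicate p c) = c := by
  induction p with
  | zero => simp [alternating]
  | succ p ih =>
    simp only [List.replicate_succ, alternating]
    omega

theorem alternating_replicate_append {p : ℕ} (hp : Even p) (c : ℕ) (l : List ℕ) :
    alternating (List.replicate p c ++ l) = alternating l := by
  obtain ⟨j, rfl⟩ := hp
  induction j with
  | zero => simp
  | succ j ih =>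
    rw [show j + 1 + (j + 1) = j + j + 1 + 1 by omega]
    simp [List.replicate_succ, alternating, ih]

theorem abs_alternating_expand_append_le (hab : a < b) (hea : Even a) (heb : Even b)
    (hc : c = a ∨ c = b) {m : List ℕ} (hm : m ∈ words a b) (q : ℕ) :
    |alternating (expand a b c (m ++ [q]))| ≤ b := by
  induction m generalizing c with
  | nil =>
    simp only [List.nil_append, expand_singleton]
    rw [abs_le]
    have := alternating_replicate q c
    omega
  | cons p m ih =>
    rw [mem_words_cons] at hm
    rw [List.cons_append, expand, alternating_replicate_append]
    · exact ih (otherLetter_mem hc) hm.2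
    · rcases hm.1 with rfl | rfl <;> assumption

theorem abs_alternating_le_of_mem_fDerivable (hab : a < b) (hea : Even a)
    (heb : Even b) {v : List ℕ} (hv : v ∈ fDerivable a b) : |alternating v| ≤ 2 * b := by
  rcases fDerivable_cases hab hv with rfl | ⟨c, p, hc, hp, hpb, rfl⟩ |
    ⟨c, p, m, q, hc, hm, hp, hq, rfl⟩
  · simp [alternating]
  · have := abs_alternating_expand_append_le hab hea heb hc nil_mem_words p
    rw [List.nil_append] at this
    omega
  · have h1 := abs_alternating_expand_append_le hab hea heb (otherLetter_mem hc) hm q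
    have h2 := alternating_replicate p c
    have h3 := alternating_append (List.replicate p c) (expand a b (otherLetter a b c) (m ++ [q]))
    rw [expand]
    rw [abs_le] at h1 ⊢
    omega

theorem two_mul_sum_expand_sub (hc : c = a ∨ c = b) (ps : List ℕ) :
    2 * ((expand a b c ps).sum : ℤ) - (a + b) * ps.sum = (2 * c - a - b) * alternating ps := by
  induction ps generalizing c with
  | nil => simp [expand, alternating]
  | cons p ps ih =>
    have h := ih (otherLetter_mem hc)
    have h' : ((otherLetter a b c : ℕ) : ℤ) = a + b - c := by unfold otherLetter; omega
    rw [h'] at h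
    simp only [expand, alternating, List.sum_append, List.sum_replicate, smul_eq_mul, List.sum_cons,
      Nat.cast_add, Nat.cast_mul]
    linear_combination h

theorem alternating_cut_mem (p : ℕ) :
    0 ≤ alternating (cut a b p) ∧ alternating (cut a b p) ≤ b := by
  unfold cut
  split <;> simp [alternating]

/-- Over an even alphabet the two letters are equally frequent in smooth words, up to a bounded
error: the difference of their numbers is the alternating sum of the runs, which is nearly the
derivative, whose own runs are even and contribute nothing to its alternating sum. -/
theorem mul_length_le_of_mem_fSmooth (ha : 1 ≤ a) (hab : a < b) (hea : Even a) (heb : Even b)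
    {w : List ℕ} (hw : w ∈ fSmooth a b) :
    (a + b) * w.length ≤ 2 * w.sum + 6 * b * b := by
  have key : ∀ c ps, (c = a ∨ c = b) → w = expand a b c ps → |alternating ps| ≤ 6 * b →
      (a + b) * w.length ≤ 2 * w.sum + 6 * b * b := by
    rintro c ps hc rfl h
    have h1 := two_mul_sum_expand_sub hc ps
    rw [length_expand]
    rw [abs_le] at h
    have h2 : ((a : ℤ) + b) * ps.sum ≤ 2 * (expand a b c ps).sum + 6 * b * b := by
      have ha0 : (0 : ℤ) ≤ a := by omega
      have hab0 : (0 : ℤ) ≤ (b : ℤ) - a := by omega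
      rcases hc with rfl | rfl
      · have h3 := mul_le_mul_of_nonneg_left h.2 hab0
        have h4 := mul_nonneg ha0 (show (0 : ℤ) ≤ b by omega)
        nlinarith
      · have h3 := mul_le_mul_of_nonneg_left h.1 hab0
        have h4 := mul_nonneg ha0 (show (0 : ℤ) ≤ c by omega)
        nlinarith
    exact_mod_cast h2
  rcases fSmooth_cases ha hab hw with rfl | ⟨c, p, hc, hp, hpb, h⟩ |
    ⟨c, p, m, q, hc, hm, hp, hq, hs, h⟩
  · simp
  · refine key c [p] hc h ?_
    simp only [alternating, sub_zero]
    rw [abs_le]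
    omega
  · refine key c _ hc h ?_
    have h1 := abs_alternating_le_of_mem_fDerivable hab hea heb (mem_fSmooth_iff.1 hs).1
    have h2 := alternating_cut_mem (a := a) (b := b) p
    have h3 := alternating_cut_mem (a := a) (b := b) q
    have h4 := alternating_append (cut a b p ++ m) (cut a b q)
    have h5 := alternating_append (cut a b p) m
    have h6 := alternating_append m [q]
    have h7 : alternating [q] = q := by simp [alternating]
    simp only [alternating]
    rw [abs_le] at h1 ⊢
    omega

/-! ### The growth of the number of smooth words: upper bound -/

/-- The mirrored special words of length at most `x`. -/
def boundedSpecial (a b : ℕ) (x : ℝ) : Set (List ℕ) :=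
  {u | u ∈ mirrorSpecial a b ∧ (u.length : ℝ) ≤ x}

/-- The mirrored special words of length at most `x` that start with the letter `c`. -/
def boundedSpecialFrom (a b c : ℕ) (x : ℝ) : Set (List ℕ) :=
  {u | u ∈ boundedSpecial a b x ∧ u.head? = some c}

theorem finite_boundedSpecial (x : ℝ) : (boundedSpecial a b x).Finite := by
  refine ((Set.finite_le_nat ⌊x⌋₊).biUnion fun i _ => finite_words_length a b i).subset ?_
  intro u hu
  simp only [Set.mem_iUnion]
  exact ⟨u.length, Nat.le_floor hu.2, mirrorSpecial_subset_words hu.1, rfl⟩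

theorem finite_boundedSpecialFrom (x : ℝ) : (boundedSpecialFrom a b c x).Finite :=
  (finite_boundedSpecial x).subset fun _ hu => hu.1

theorem ncard_boundedSpecial_le (x : ℝ) : (boundedSpecial a b x).ncard ≤
    1 + (boundedSpecialFrom a b a x).ncard + (boundedSpecialFrom a b b x).ncard := by
  have h : boundedSpecial a b x ⊆
      ({[]} ∪ boundedSpecialFrom a b a x) ∪ boundedSpecialFrom a b b x := by
    intro u hu
    rcases u with _ | ⟨y, u⟩
    · exact Or.inl (Or.inl rfl)
    · rcases (mem_words_cons.1 (mirrorSpecial_subset_words hu.1)).1 with rfl | rfl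
      · exact Or.inl (Or.inr ⟨hu, rfl⟩)
      · exact Or.inr ⟨hu, rfl⟩
  refine (Set.ncard_le_ncard h (((Set.finite_singleton _).union
    (finite_boundedSpecialFrom x)).union (finite_boundedSpecialFrom x))).trans ?_
  refine (Set.ncard_union_le _ _).trans (Nat.add_le_add_right ?_ _)
  exact (Set.ncard_union_le _ _).trans (by simp)

/-- A special word with first letter `c` and at least two blocks is determined by its first block
length `p` and its derivative, which has to start with `b` when `p > a`. -/
theorem ncard_boundedSpecialFrom_le (ha : 1 ≤ a) (hab : a < b) (hea : Even a) (heb : Even b)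
    {x x' : ℝ} (hx : 2 * x + 2 * b + 6 * b * b ≤ (a + b) * x') :
    (boundedSpecialFrom a b c x).ncard ≤ (b + 1) + a * (boundedSpecial a b x').ncard +
      (b - a) * (boundedSpecialFrom a b b x').ncard := by
  have h : boundedSpecialFrom a b c x ⊆
      ((fun p => expand a b c [p]) '' (Finset.range (b + 1) : Set ℕ) ∪
        (fun pw : ℕ × List ℕ => expand a b c (pw.1 :: (pw.2 ++ [a]))) ''
          ((Finset.Icc 1 a : Set ℕ) ×ˢ boundedSpecial a b x')) ∪
        (fun pw : ℕ × List ℕ => expand a b c (pw.1 :: (pw.2.tail ++ [a]))) ''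
          ((Finset.Ioc a b : Set ℕ) ×ˢ boundedSpecialFrom a b b x') := by
    rintro u ⟨⟨hu, hux⟩, huc⟩
    rcases mirrorSpecial_cases ha hab hu with ⟨c', p, hc', hpb, rfl⟩ |
      ⟨c', p, m, hc', hm, hp, hR, rfl⟩
    · refine Or.inl (Or.inl ⟨p, by simpa using by omega, ?_⟩)
      rcases Nat.eq_zero_or_pos p with rfl | hp
      · rfl
      · rw [head?_expand hp, Option.some.injEq] at huc
        rw [huc]
    · rw [head?_expand hp.1, Option.some.injEq] at huc
      subst huc
      have hlen : ((cut a b p ++ m).length : ℝ) ≤ x' := by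
        have h1 := mul_length_le_of_mem_fSmooth ha hab hea heb
          (reverse_mem_fSmooth_of_mirrorSpecial ha hab hR)
        rw [List.length_reverse, List.sum_reverse] at h1
        have h2 : (cut a b p ++ m).sum ≤ (expand a b c' (p :: (m ++ [a]))).length + b := by
          have : (cut a b p).sum ≤ b := by unfold cut; split <;> simp
          rw [length_expand]
          simp only [List.sum_append, List.sum_cons]
          omega
        have h1' : ((a : ℝ) + b) * ((cut a b p ++ m).length : ℝ) ≤
            2 * ((cut a b p ++ m).sum : ℝ) + 6 * b * b := by exact_mod_cast h1
        have h2' : ((cut a b p ++ m).sum : ℝ) ≤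
            ((expand a b c' (p :: (m ++ [a]))).length : ℝ) + b := by exact_mod_cast h2
        have hpos : (0 : ℝ) < a + b := by exact_mod_cast (by omega : 0 < a + b)
        refine le_of_mul_le_mul_left ?_ hpos
        linarith
      rcases le_or_gt p a with hpa | hpa
      · rw [cut_of_le hpa] at hR hlen
        exact Or.inl (Or.inr ⟨(p, m), ⟨by simpa using ⟨hp.1, hpa⟩, hR, hlen⟩, rfl⟩)
      · rw [cut_of_lt hpa] at hR hlen
        exact Or.inr ⟨(p, b :: m), ⟨by simpa using ⟨hpa, hp.2⟩, ⟨hR, hlen⟩, rfl⟩, rfl⟩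
  have hf1 : (((Finset.range (b + 1) : Finset ℕ) : Set ℕ)).Finite := Finset.finite_toSet _
  have hf2 := (Finset.finite_toSet (Finset.Icc 1 a)).prod (finite_boundedSpecial (a := a) (b := b) x')
  have hf3 := (Finset.finite_toSet (Finset.Ioc a b)).prod
    (finite_boundedSpecialFrom (a := a) (b := b) (c := b) x')
  refine (Set.ncard_le_ncard h (((hf1.image _).union (hf2.image _)).union (hf3.image _))).trans ?_
  refine (Set.ncard_union_le _ _).trans (Nat.add_le_add ?_ ?_)
  · refine (Set.ncard_union_le _ _).trans (Nat.add_le_add ?_ ?_)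
    · refine (Set.ncard_image_le hf1).trans ?_
      rw [Set.ncard_coe_finset, Finset.card_range]
    · refine (Set.ncard_image_le hf2).trans ?_
      rw [Set.ncard_prod, Set.ncard_coe_finset, Nat.card_Icc, Nat.add_sub_cancel]
  · refine (Set.ncard_image_le hf3).trans ?_
    rw [Set.ncard_prod, Set.ncard_coe_finset, Nat.card_Ioc]

/-- The combinatorial upper bound. The constant `b + 3 * b * b` absorbs the bounded errors in the
relation between the lengths of a word and of its derivative. -/
theorem exists_ncard_boundedSpecialFrom_le (ha : 1 ≤ a) (hab : a < b) (hea : Even a)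
    (heb : Even b) : ∃ K : ℕ, ∀ k : ℕ, ∀ c, (c = a ∨ c = b) →
      (boundedSpecialFrom a b c ((((a : ℝ) + b) / 2) ^ k + (b + 3 * b * b))).ncard + 2 ≤
        K * (a + b) ^ k := by
  set x : ℕ → ℝ := fun k => (((a : ℝ) + b) / 2) ^ k + (b + 3 * b * b) with hx
  refine ⟨(boundedSpecialFrom a b a (x 0)).ncard + (boundedSpecialFrom a b b (x 0)).ncard + 2,
    fun k => ?_⟩
  generalize hK : (boundedSpecialFrom a b a (x 0)).ncard +
    (boundedSpecialFrom a b b (x 0)).ncard + 2 = K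
  induction k with
  | zero =>
    intro c hc
    change (boundedSpecialFrom a b c (x 0)).ncard + 2 ≤ _
    rw [pow_zero (a + b), mul_one]
    rcases hc with h | h <;> rw [h] <;> omega
  | succ k ih =>
    intro c hc
    have hstep : 2 * x (k + 1) + 2 * b + 6 * b * b ≤ (a + b) * x k := by
      have h4 : (4 : ℝ) ≤ a + b := by
        obtain ⟨i, rfl⟩ := hea
        obtain ⟨j, rfl⟩ := heb
        exact_mod_cast (by omega : 4 ≤ i + i + (j + j))
      have h5 : (0 : ℝ) ≤ b + 3 * b * b := by positivity
      simp only [hx, pow_succ]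
      nlinarith
    have h1 := ncard_boundedSpecialFrom_le (c := c) ha hab hea heb hstep
    have h2 := ncard_boundedSpecial_le (a := a) (b := b) (x k)
    have h3 := ih a (Or.inl rfl)
    have h4 := ih b (Or.inr rfl)
    change (boundedSpecialFrom a b a (x k)).ncard + 2 ≤ _ at h3
    change (boundedSpecialFrom a b b (x k)).ncard + 2 ≤ _ at h4
    change (boundedSpecialFrom a b c (x (k + 1))).ncard + 2 ≤ _
    obtain ⟨d, rfl⟩ : ∃ d, b = a + d := ⟨b - a, by omega⟩
    rw [Nat.add_sub_cancel_left] at h1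
    generalize hM : K * (a + (a + d)) ^ k = M at h3 h4
    have h6 := Nat.mul_le_mul_left a (show (boundedSpecial a (a + d) (x k)).ncard + 3 ≤ 2 * M by
      omega)
    have h7 := Nat.mul_le_mul_left d h4
    rw [pow_succ, ← mul_assoc, hM]
    nlinarith

theorem complexity_isBigO_rpow {ρ : ℝ} (ha : 1 ≤ a) (hab : a < b) (hea : Even a) (heb : Even b)
    (hρ : ρ = Real.log ((a : ℝ) + (b : ℝ)) / Real.log (((a : ℝ) + (b : ℝ)) / 2)) :
    (fun n : ℕ => (complexity (fSmooth a b) n : ℝ)) =O[atTop] fun n : ℕ => (n : ℝ) ^ ρ := by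
  obtain ⟨hl, hρ0, hpow⟩ := rpow_exponent ha hab hρ
  obtain ⟨K, hK⟩ := exists_ncard_boundedSpecialFrom_le ha hab hea heb
  refine IsBigO.of_bound (2 * K * (a + b)) ?_
  filter_upwards [eventually_ge_atTop 1] with n hn
  obtain ⟨k, hk1, hk2⟩ := exists_nat_pow_near (x := (n : ℝ)) (y := ((a : ℝ) + b) / 2)
    (by exact_mod_cast hn) hl
  have h1 := complexity_fSmooth_le ha hab n
  have h2 : {u | u ∈ mirrorSpecial a b ∧ u.length < n}.ncard ≤
      (boundedSpecial a b ((((a : ℝ) + b) / 2) ^ (k + 1) + (b + 3 * b * b))).ncard := by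
    refine Set.ncard_le_ncard (fun u hu => ⟨hu.1, ?_⟩) (finite_boundedSpecial _)
    have h3 : (u.length : ℝ) ≤ n := by exact_mod_cast hu.2.le
    have h4 : (0 : ℝ) ≤ b + 3 * b * b := by positivity
    linarith
  have h3 := ncard_boundedSpecial_le (a := a) (b := b)
    ((((a : ℝ) + b) / 2) ^ (k + 1) + (b + 3 * b * b))
  have h4 := hK (k + 1) a (Or.inl rfl)
  have h5 := hK (k + 1) b (Or.inr rfl)
  have h6 : complexity (fSmooth a b) n ≤ 2 * (K * (a + b) ^ (k + 1)) := by omega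
  have h7 : (complexity (fSmooth a b) n : ℝ) ≤ 2 * (K * ((a : ℝ) + b) ^ (k + 1)) := by
    exact_mod_cast h6
  have h8 : ((a : ℝ) + b) ^ k ≤ (n : ℝ) ^ ρ := by
    rw [← hpow]
    exact Real.rpow_le_rpow (by positivity) hk1 hρ0
  rw [Real.norm_of_nonneg (by positivity), Real.norm_of_nonneg (by positivity)]
  calc (complexity (fSmooth a b) n : ℝ) ≤ 2 * (K * ((a : ℝ) + b) ^ (k + 1)) := h7
    _ = 2 * K * (a + b) * ((a : ℝ) + b) ^ k := by ring
    _ ≤ _ := mul_le_mul_of_nonneg_left h8 (by positivity)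

end

theorem theorem2 (a b : ℕ) (ha : 1 ≤ a) (hab : a < b) (ρ : ℝ)
    (hρ : ρ = Real.log ((a : ℝ) + (b : ℝ)) / Real.log (((a : ℝ) + (b : ℝ)) / 2)) :
    ((fun n : ℕ => (n : ℝ) ^ ρ) =O[atTop] fun n : ℕ => (complexity (fSmooth a b) n : ℝ)) ∧
    (Even a → Even b →
      (fun n : ℕ => (complexity (fSmooth a b) n : ℝ)) =Θ[atTop] fun n : ℕ => (n : ℝ) ^ ρ) := by
  have h := rpow_isBigO_complexity ha hab hρ
  exact ⟨h, fun hea heb => ⟨complexity_isBigO_rpow ha hab hea heb hρ, h⟩⟩
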